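/- For a complex $m\times n$ matrix $X$ let $\|X\|_F$ be the norm of the operator $F_X: z\mapsto Xz$ from $(\mathbb C^n,\|\cdot\|_\infty)$ to $(\mathbb C^m,\|\cdot\|_2)$, and let $\|X\|_{cbF}$ be the completely bounded norm of $F_X:\mathcal A_n\to\mathbb C^m$, where $\mathcal A_n=\mathbb C^n$ is the $n$-dimensional commutative C*-algebra and $\mathbb C^m=M_{(m,1)}(\mathbb C)$ is the column Hilbert space. Let $k_G^{\mathbb C}$ be the complex little Grothendieck constant, i.e. the infimum of the constants $K>0$ such that $\|X\|_{cbF}\le\sqrt K\,\|X\|_F$ for all complex matrices $X$ of all sizes. Let $\mathcal Q_n$ be the set of positive semidefinite complex $n\times n$ matrices all of whose diagonal entries are $1$, and let $\mathcal R_n$ be the closed convex hull in $M_n(\mathbb C)$ of the rank one matrices $(\bar u_iu_j)_{i,j}$, where $u\in\mathbb C^n$ and $|u_i|=1$ for all $i$. Then such constants $K$ exist, the infimum $k_G^{\mathbb C}$ is attained, $k_G^{\mathbb C}<2$, and for every natural number $n$ and every $Q\in\mathcal Q_n$ there are $R_+,R_-\in\mathcal R_n$ such that $$Q=\frac{1}{2-k_G^{\mathbb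 C}}\,R_+-\frac{k_G^{\mathbb C}-1}{2-k_G^{\mathbb C}}\,R_-.$$ -/

import Mathlib

noncomputable section

/-- The operator norm of a complex `p × q` matrix acting between Euclidean spaces. -/
def opNorm {p q : Type*} [Fintype p] [Fintype q] [DecidableEq q] (A : Matrix p q ℂ) : ℝ :=
  ‖Matrix.toEuclideanLin.trans LinearMap.toContinuousLinearMap A‖

/-- `‖X‖_F`: the norm of the operator `F_X : z ↦ X z` from `(ℂⁿ, ‖·‖_∞)` (in Mathlib,
`Fin n → ℂ` with its sup norm) to `(ℂᵐ, ‖·‖₂)`. -/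
def normF {m n : ℕ} (X : Matrix (Fin m) (Fin n) ℂ) : ℝ :=
  ‖LinearMap.toContinuousLinearMap
    ((WithLp.linearEquiv 2 ℂ (Fin m → ℂ)).symm.toLinearMap ∘ₗ X.mulVecLin)‖

/-- The C⋆-norm on `M_k(A_n)`, where `A_n = ℂⁿ` is the commutative C⋆-algebra of functions on
`n` points: the maximum over the points `j` of the operator norm of the value at `j`. -/
def matNormAlg {n k : ℕ} (a : Matrix (Fin k) (Fin k) (Fin n → ℂ)) : ℝ :=
  ⨆ j : Fin n, opNorm (a.map fun z => z j)

/-- The norm on `M_k(ℂᵐ)`, where `ℂᵐ = M_{m,1}(ℂ)` is the (column) Hilbert space: a `k × k` matrix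
of columns of length `m` is an `mk × k` scalar matrix and carries its operator norm. -/
def matNormCol {m k : ℕ} (b : Matrix (Fin k) (Fin k) (Fin m → ℂ)) : ℝ :=
  opNorm (Matrix.of fun (ip : Fin m × Fin k) (q : Fin k) => b ip.2 q ip.1)

/-- The norms of the images of the unit balls of all the `M_k(A_n)` under the amplifications
of a linear map `F : A_n → ℂᵐ` (`F` applied to every entry). -/
def cbSet {m n : ℕ} (F : (Fin n → ℂ) →ₗ[ℂ] (Fin m → ℂ)) : Set ℝ :=
  {c | ∃ (k : ℕ) (a : Matrix (Fin k) (Fin k) (Fin n → ℂ)),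
    matNormAlg a ≤ 1 ∧ c = matNormCol (a.map F)}

/-- `‖X‖_cbF`: the completely bounded norm of `F_X : A_n → ℂᵐ`, that is, the supremum over all `k`
of the norms of its amplifications `M_k(A_n) → M_k(ℂᵐ)`. -/
def normCbF {m n : ℕ} (X : Matrix (Fin m) (Fin n) ℂ) : ℝ :=
  sSup (cbSet X.mulVecLin)

open scoped Matrix.Norms.L2Operator in
/-- The supremum defining the completely bounded norm is that of a bounded set. -/
theorem bddAbove_cbSet {m n : ℕ} (X : Matrix (Fin m) (Fin n) ℂ) :
    BddAbove (cbSet X.mulVecLin) := by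
  refine ⟨∑ i, ∑ j, ‖X i j‖, ?_⟩
  rintro c ⟨k, a, ha, rfl⟩
  have ha' : ∀ j, ‖a.map fun z => z j‖ ≤ 1 := fun j =>
    (le_ciSup (f := fun j : Fin n => opNorm (a.map fun z => z j))
      (Set.finite_range _).bddAbove j).trans ha
  let E : Fin m → Matrix (Fin m × Fin k) (Fin k) ℂ := fun i =>
    Matrix.of fun ip q => if ip.1 = i ∧ ip.2 = q then 1 else 0
  have hE : ∀ i, ‖E i‖ ≤ 1 := by
    intro i
    have h1 : (E i).conjTranspose * E i = 1 := by
      ext p q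
      simp only [E, Matrix.mul_apply, Matrix.conjTranspose_apply, Matrix.of_apply,
        Fintype.sum_prod_type, Matrix.one_apply]
      rw [Finset.sum_eq_single i (fun b _ hb => by simp [hb]) (by simp)]
      rw [Finset.sum_eq_single p (fun b _ hb => by simp [hb]) (by simp)]
      simp
    have h2 := Matrix.l2_opNorm_conjTranspose_mul_self (E i)
    rw [h1] at h2
    have h3 : ‖(1 : Matrix (Fin k) (Fin k) ℂ)‖ ≤ 1 := by
      rw [← Matrix.diagonal_one, Matrix.l2_opNorm_diagonal]
      exact (pi_norm_le_iff_of_nonneg zero_le_one).2 (by simp)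
    nlinarith [norm_nonneg (E i)]
  have key : (Matrix.of fun (ip : Fin m × Fin k) (q : Fin k) =>
      (a.map X.mulVecLin) ip.2 q ip.1) =
      ∑ i, E i * ∑ j, X i j • a.map fun z => z j := by
    ext ⟨i, p⟩ q
    rw [Matrix.sum_apply, Finset.sum_eq_single i]
    · rw [Matrix.mul_apply, Finset.sum_eq_single p (fun b _ hb => by simp [E, hb.symm]) (by simp)]
      simp [E, Matrix.sum_apply, Matrix.mulVec, dotProduct]
    · intro b _ hb
      simp [Matrix.mul_apply, E, hb.symm]
    · simp
  change ‖Matrix.of fun (ip : Fin m × Fin k) (q : Fin k) =>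
    (a.map X.mulVecLin) ip.2 q ip.1‖ ≤ _
  rw [key]
  refine (norm_sum_le _ _).trans (Finset.sum_le_sum fun i _ => ?_)
  refine (Matrix.l2_opNorm_mul _ _).trans ?_
  refine (mul_le_of_le_one_left (norm_nonneg _) (hE i)).trans ?_
  refine (norm_sum_le _ _).trans (Finset.sum_le_sum fun j _ => ?_)
  rw [norm_smul]
  exact mul_le_of_le_one_right (norm_nonneg _) (ha' j)

/-- The positive constants `K` for which the complex little Grothendieck inequality
`‖X‖_cbF ≤ √K ‖X‖_F` holds for all complex matrices of all sizes. -/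
def littleGrothendieckSet : Set ℝ :=
  {K | 0 < K ∧ ∀ (m n : ℕ) (X : Matrix (Fin m) (Fin n) ℂ), normCbF X ≤ √K * normF X}

/-- The complex little Grothendieck constant `k_G^ℂ`. -/
def kGC : ℝ := sInf littleGrothendieckSet

open scoped ComplexOrder in
/-- `𝒬_n`: the positive semidefinite complex `n × n` matrices with diagonal `I_n`. -/
def setQ (n : ℕ) : Set (Matrix (Fin n) (Fin n) ℂ) :=
  {X | X.PosSemidef ∧ ∀ i, X i i = 1}

/-- `ℛ_n`: the closed convex hull of the rank one matrices `(ū_i u_j)`, where `u` is a unitary of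
the C⋆-algebra `A_n = ℂⁿ`. -/
def setR (n : ℕ) : Set (Matrix (Fin n) (Fin n) ℂ) :=
  closure (convexHull ℝ {M | ∃ u ∈ unitary (Fin n → ℂ), M = Matrix.vecMulVec (star u) u})

end

open MeasureTheory ProbabilityTheory
open scoped ComplexOrder Matrix

/-! Write `k = kGC`. The core is a duality, `exists_posSemidef_smul_sub`: if `K` is admissible,
every correlation matrix `Q` satisfies `Q ≤ K R` for some `R` in `setR n`. Otherwise Hahn-Banach
separates `K • setR n - Q` from the positive semidefinite cone. The functional is nonnegative on
that cone, so on rank one matrices it is `‖X x‖²` for some matrix `X`, and this `X` violates the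
inequality for `K`. All diagonals being `1`, the remainder `k R - Q` equals `(k - 1) Q'` with `Q'`
again a correlation matrix (`exists_eq_smul_sub_smul`). Substituting twice gives `Q = k R - k (k -
1) R' + (k - 1)² Q''`. Since `1 ≤ k < 2` this iterates to a geometric series, and `1 - (k - 1)² = k
(2 - k)` yields the stated coefficients. Only `k < 2` is needed here, so a crude Gaussian rounding
with constant `π / 2` suffices (`sum_norm_sq_le_normF_sq`). -/

theorem integral_abs_gaussianReal : ∫ x, |x| ∂(gaussianReal 0 1) = √(2 / Real.pi) := by
  rw [integral_gaussianReal_eq_integral_smul one_ne_zero]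
  have h1 : ∀ x : ℝ, gaussianPDFReal 0 1 x • |x| =
      (fun y => (√(2 * Real.pi))⁻¹ * (y * Real.exp (-(1/2) * y ^ 2))) |x| := by
    intro x
    simp only [gaussianPDFReal, sq_abs, smul_eq_mul, NNReal.coe_one, sub_zero, mul_one]
    rw [show -x ^ 2 / 2 = -(1/2) * x ^ 2 by ring]
    ring
  rw [integral_congr_ae (Filter.Eventually.of_forall h1), integral_comp_abs
    (f := fun y => (√(2 * Real.pi))⁻¹ * (y * Real.exp (-(1/2) * y ^ 2))), integral_const_mul]
  have h2 := integral_rpow_mul_exp_neg_mul_rpow (p := 2) (q := 1) (b := 1/2) (by norm_num)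
    (by norm_num) (by norm_num)
  have h3 : ∫ x in Set.Ioi (0:ℝ), x * Real.exp (-(1/2) * x ^ 2) = 1 := by
    have h4 : (1 / 2 : ℝ) ^ (-(1 + 1) / 2 : ℝ) * (1 / 2) * Real.Gamma ((1 + 1) / 2) = 1 := by
      norm_num [Real.rpow_neg_one]
    refine Eq.trans ?_ (h2.trans h4)
    refine setIntegral_congr_fun measurableSet_Ioi fun x _ => ?_
    simp
  rw [h3, mul_one, Real.sqrt_div zero_le_two, Real.sqrt_mul zero_le_two, mul_inv,
    div_eq_mul_inv, ← mul_assoc]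
  congr 1
  rw [← div_eq_mul_inv, Real.div_sqrt]

/-! ### Gaussian integrals on a real Euclidean space. -/

section
variable {H : Type*} [NormedAddCommGroup H] [InnerProductSpace ℝ H] [FiniteDimensional ℝ H]
  [MeasurableSpace H] [BorelSpace H]

theorem memLp_inner_stdGaussian (w : H) : MemLp (fun x => inner ℝ w x) 2 (stdGaussian H) :=
  (IsGaussian.memLp_two_id (μ := stdGaussian H)).const_inner w

theorem integral_inner_sq_stdGaussian (w : H) :
    ∫ x, (inner ℝ w x) ^ 2 ∂(stdGaussian H) = ‖w‖ ^ 2 := by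
  have h := variance_dual_stdGaussian (innerSL ℝ w)
  rw [innerSL_apply_norm, variance_of_integral_eq_zero (by fun_prop)
    (integral_strongDual_stdGaussian _)] at h
  simpa using h

theorem map_inner_stdGaussian (w : H) (hw : ‖w‖ = 1) :
    (stdGaussian H).map (fun x => inner ℝ w x) = gaussianReal 0 1 := by
  have h := IsGaussian.map_eq_gaussianReal (μ := stdGaussian H) (innerSL ℝ w)
  rw [integral_strongDual_stdGaussian, variance_dual_stdGaussian, innerSL_apply_norm, hw] at h
  simpa using h

theorem integral_abs_inner_stdGaussian (w : H) (hw : ‖w‖ = 1) :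
    ∫ x, |inner ℝ w x| ∂(stdGaussian H) = √(2 / Real.pi) := by
  rw [← integral_abs_gaussianReal, ← map_inner_stdGaussian w hw,
    integral_map (by fun_prop) (by fun_prop)]

theorem measurable_sign_real : Measurable Real.sign := by
  unfold Real.sign
  exact Measurable.ite measurableSet_Iio measurable_const
    (Measurable.ite measurableSet_Ioi measurable_const measurable_const)

theorem abs_sign_le_one (x : ℝ) : |Real.sign x| ≤ 1 := by
  rcases Real.sign_apply_eq x with h | h | h <;> simp [h]

theorem memLp_sign_inner_stdGaussian (p : H) :
    MemLp (fun x => Real.sign (inner ℝ p x)) 2 (stdGaussian H) :=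
  MemLp.of_bound (measurable_sign_real.comp (by fun_prop)).aestronglyMeasurable 1
    (Filter.Eventually.of_forall fun x => abs_sign_le_one _)

/-- The reflection in the hyperplane orthogonal to `w` preserves the Gaussian measure, fixes `p` and
negates `w`, so the integral equals its own negative. -/
theorem integral_sign_inner_mul_inner_orthogonal (p w : H) (h : inner ℝ p w = 0) :
    ∫ x, Real.sign (inner ℝ p x) * inner ℝ w x ∂(stdGaussian H) = 0 := by
  have hr := stdGaussian_map ((ℝ ∙ w)ᗮ.reflection)
  have h1 : ∫ x, Real.sign (inner ℝ p x) * inner ℝ w x ∂(stdGaussian H) =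
      ∫ x, -(Real.sign (inner ℝ p x) * inner ℝ w x) ∂(stdGaussian H) := by
    conv_lhs => rw [← hr]
    have hm : Measurable fun x : H => Real.sign (inner ℝ p x) * inner ℝ w x :=
      (measurable_sign_real.comp (by fun_prop)).mul (by fun_prop)
    rw [integral_map (by fun_prop) hm.aestronglyMeasurable]
    congr 1 with x
    have hp : (ℝ ∙ w)ᗮ.reflection p = p :=
      Submodule.reflection_mem_subspace_eq_self
        (Submodule.mem_orthogonal_singleton_iff_inner_left.2 h)
    have hw : (ℝ ∙ w)ᗮ.reflection w = -w := Submodule.reflection_orthogonalComplement_singleton_eq_neg w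
    have e1 : inner ℝ p ((ℝ ∙ w)ᗮ.reflection x) = inner ℝ p x := by
      conv_lhs => rw [← hp]
      exact LinearIsometryEquiv.inner_map_map _ _ _
    have e2 : inner ℝ w ((ℝ ∙ w)ᗮ.reflection x) = -inner ℝ w x := by
      have := LinearIsometryEquiv.inner_map_map ((ℝ ∙ w)ᗮ.reflection) w x
      rw [hw, inner_neg_left] at this
      linarith
    rw [e1, e2]; ring
  rw [integral_neg] at h1
  linarith

/-- Only the component of `w` along `p` contributes. The weight `‖p‖` makes the right side bilinear,
although the sign is not linear in `p`. -/
theorem integral_sign_inner_mul_inner (p w : H) :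
    ∫ x, (‖p‖ * Real.sign (inner ℝ p x)) * inner ℝ w x ∂(stdGaussian H) =
      √(2 / Real.pi) * inner ℝ p w := by
  rcases eq_or_ne p 0 with rfl | hp
  · simp
  have hn : ‖p‖ ≠ 0 := norm_ne_zero_iff.2 hp
  set e : H := ‖p‖⁻¹ • p with he
  have he1 : ‖e‖ = 1 := by rw [he, norm_smul, norm_inv, norm_norm, inv_mul_cancel₀ hn]
  have hpe : p = ‖p‖ • e := by rw [he, smul_smul, mul_inv_cancel₀ hn, one_smul]
  have hs : ∀ x, Real.sign (inner ℝ p x) * inner ℝ e x = |inner ℝ e x| := by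
    intro x
    conv_lhs => rw [hpe]
    rw [real_inner_smul_left]
    have : 0 < ‖p‖ := by positivity
    rcases lt_trichotomy (inner ℝ e x) 0 with h | h | h
    · rw [Real.sign_of_neg (mul_neg_of_pos_of_neg this h), abs_of_neg h]; ring
    · simp [h]
    · rw [Real.sign_of_pos (mul_pos this h), abs_of_pos h]; ring
  set v : H := w - (inner ℝ e w) • e with hv
  have hpv : inner ℝ p v = 0 := by
    rw [hpe, hv, real_inner_smul_left, inner_sub_right, real_inner_smul_right,
      real_inner_self_eq_norm_sq, he1]
    ring
  have h0 := integral_sign_inner_mul_inner_orthogonal p v hpv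
  have hi : ∀ z : H, Integrable (fun x => Real.sign (inner ℝ p x) * inner ℝ z x) (stdGaussian H) :=
    fun z => (memLp_sign_inner_stdGaussian p).integrable_mul (memLp_inner_stdGaussian z)
  have hsplit : ∀ x, (‖p‖ * Real.sign (inner ℝ p x)) * inner ℝ w x =
      ‖p‖ * (Real.sign (inner ℝ p x) * inner ℝ v x + inner ℝ e w * |inner ℝ e x|) := by
    intro x
    rw [← hs, hv, inner_sub_left, real_inner_smul_left]
    ring
  simp_rw [hsplit]
  rw [integral_const_mul, integral_add (hi v), h0, integral_const_mul,
    integral_abs_inner_stdGaussian e he1]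
  · conv_rhs => rw [hpe, real_inner_smul_left]
    ring
  · simp_rw [← hs]
    exact (hi e).const_mul _

end

/-! ### Quadrant rounding of complex Gaussian variables. -/

theorem integrable_inner_of_memLp_two {α F : Type*} {mα : MeasurableSpace α} {μ : Measure α}
    [NormedAddCommGroup F] [InnerProductSpace ℝ F] {f g : α → F} (hf : MemLp f 2 μ)
    (hg : MemLp g 2 μ) : Integrable (fun x => (inner ℝ (f x) (g x) : ℝ)) μ :=
  (hf.norm.integrable_mul hg.norm).mono' (hf.1.inner hg.1)
    (Filter.Eventually.of_forall fun _ => norm_inner_le_norm _ _)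

/-- The complex Gaussian variable `⟪·, b⟫` on `ℂᵏ`. -/
noncomputable def gaussCoord {k : ℕ} (b ξ : EuclideanSpace ℂ (Fin k)) : ℂ := inner ℂ ξ b

/-- A random point of the disc, aligned with the quadrant of `gaussCoord b`. -/
noncomputable def quadrantSign {k : ℕ} (b ξ : EuclideanSpace ℂ (Fin k)) : ℂ :=
  ⟨‖b‖ * Real.sign (inner ℝ b ξ) / √2,
    ‖b‖ * Real.sign (inner ℝ (-(Complex.I • b)) ξ) / √2⟩

section
variable {k : ℕ} (b w ξ : EuclideanSpace ℂ (Fin k))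

theorem real_inner_eq_re_inner_euclidean : inner ℝ b ξ = (inner ℂ b ξ).re := by
  simp [PiLp.inner_apply, Complex.inner]

theorem gaussCoord_re : (gaussCoord b ξ).re = inner ℝ b ξ := by
  rw [real_inner_comm, real_inner_eq_re_inner_euclidean, gaussCoord]

theorem gaussCoord_im : (gaussCoord b ξ).im = inner ℝ (-(Complex.I • b)) ξ := by
  rw [real_inner_comm, real_inner_eq_re_inner_euclidean, gaussCoord, inner_neg_right,
    inner_smul_right]
  simp

theorem norm_neg_I_smul : ‖-(Complex.I • b)‖ = ‖b‖ := by
  rw [norm_neg, norm_smul, Complex.norm_I, one_mul]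

theorem inner_neg_I_smul :
    inner ℝ (-(Complex.I • b)) (-(Complex.I • w)) = inner ℝ b w := by
  rw [real_inner_eq_re_inner_euclidean, real_inner_eq_re_inner_euclidean, inner_neg_neg,
    inner_smul_left, inner_smul_right, ← mul_assoc]
  simp

/-- Each coordinate is at most `‖b‖ / √2` in absolute value. Hence every sample of the rounding is
an admissible test vector for `normF`. -/
theorem norm_quadrantSign_le : ‖quadrantSign b ξ‖ ≤ ‖b‖ := by
  have h2 : ∀ s : ℝ, |s| ≤ 1 → (‖b‖ * s / √2) * (‖b‖ * s / √2) ≤ ‖b‖ ^ 2 / 2 := by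
    intro s hs
    rw [div_mul_div_comm, Real.mul_self_sqrt zero_le_two]
    have h5 : s ^ 2 ≤ 1 := by rwa [sq_le_one_iff_abs_le_one]
    nlinarith [sq_nonneg ‖b‖]
  have h := add_le_add (h2 _ (abs_sign_le_one (inner ℝ b ξ)))
    (h2 _ (abs_sign_le_one (inner ℝ (-(Complex.I • b)) ξ)))
  rw [Complex.norm_def, Real.sqrt_le_left (norm_nonneg _), Complex.normSq_apply]
  simpa only [quadrantSign, add_halves] using h

theorem memLp_gaussCoord :
    MemLp (gaussCoord b) 2 (stdGaussian (EuclideanSpace ℂ (Fin k))) := by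
  rw [← memLp_re_im_iff]
  refine ⟨?_, ?_⟩
  · simpa [gaussCoord_re] using memLp_inner_stdGaussian b
  · simpa [gaussCoord_im] using memLp_inner_stdGaussian (-(Complex.I • b))

theorem memLp_quadrantSign :
    MemLp (quadrantSign b) 2 (stdGaussian (EuclideanSpace ℂ (Fin k))) := by
  rw [← memLp_re_im_iff]
  exact ⟨((memLp_sign_inner_stdGaussian _).const_mul _).mul_const (√2)⁻¹,
    ((memLp_sign_inner_stdGaussian _).const_mul _).mul_const (√2)⁻¹⟩

theorem integral_norm_sq_gaussCoord :
    ∫ ξ, ‖gaussCoord b ξ‖ ^ 2 ∂(stdGaussian (EuclideanSpace ℂ (Fin k))) = 2 * ‖b‖ ^ 2 := by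
  simp_rw [Complex.sq_norm, Complex.normSq_apply, gaussCoord_re, gaussCoord_im, ← sq]
  rw [integral_add (memLp_inner_stdGaussian _).integrable_sq
    (memLp_inner_stdGaussian _).integrable_sq, integral_inner_sq_stdGaussian,
    integral_inner_sq_stdGaussian, norm_neg_I_smul]
  ring

/-- Multiplication by `-I` turns the imaginary part into another real coordinate; each of the two
contributes `√(2 / π) / √2 = 1 / √π`. -/
theorem integral_re_quadrantSign_mul_conj_gaussCoord :
    ∫ ξ, (inner ℝ (quadrantSign b ξ) (gaussCoord w ξ))
      ∂(stdGaussian (EuclideanSpace ℂ (Fin k))) = 2 / √Real.pi * inner ℝ b w := by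
  have h : ∀ ξ, inner ℝ (quadrantSign b ξ) (gaussCoord w ξ) =
      ((‖b‖ * Real.sign (inner ℝ b ξ)) * inner ℝ w ξ +
      (‖-(Complex.I • b)‖ * Real.sign (inner ℝ (-(Complex.I • b)) ξ)) *
        inner ℝ (-(Complex.I • w)) ξ) / √2 := by
    intro ξ
    rw [Complex.inner, Complex.mul_re, Complex.conj_re, Complex.conj_im, gaussCoord_re,
      gaussCoord_im, norm_neg_I_smul]
    simp only [quadrantSign]
    ring
  have hi : ∀ p z : EuclideanSpace ℂ (Fin k),
      Integrable (fun x => (‖p‖ * Real.sign (inner ℝ p x)) * inner ℝ z x) (stdGaussian _) :=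
    fun p z => ((memLp_sign_inner_stdGaussian p).const_mul _).integrable_mul
      (memLp_inner_stdGaussian z)
  simp_rw [h]
  rw [integral_div, integral_add (hi _ _) (hi _ _), integral_sign_inner_mul_inner,
    integral_sign_inner_mul_inner, inner_neg_I_smul, Real.sqrt_div zero_le_two]
  have : √2 ≠ 0 := by positivity
  field_simp
  ring

/-- The little Grothendieck inequality for one row, in the mean. -/
theorem norm_sq_sum_smul_le_integral {n : ℕ} (a : Fin n → ℂ)
    (v : Fin n → EuclideanSpace ℂ (Fin k)) :
    2 / Real.pi * ‖∑ j, a j • v j‖ ^ 2 ≤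
      ∫ ξ, ‖∑ j, a j * quadrantSign (v j) ξ‖ ^ 2 ∂(stdGaussian (EuclideanSpace ℂ (Fin k))) := by
  set μ := stdGaussian (EuclideanSpace ℂ (Fin k))
  set s := ∑ j, a j • v j with hs
  -- The maximiser of `2 t (2 / √π) - 2 t²`, the bound obtained by expanding `‖U - t G‖² ≥ 0` in the
  -- mean; the maximum is `2 / π`.
  set t : ℝ := 1 / √Real.pi with ht
  have hU : MemLp (fun ξ => ∑ j, a j * quadrantSign (v j) ξ) 2 μ :=
    memLp_finsetSum _ fun j _ => (memLp_quadrantSign (v j)).const_mul (a j)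
  have hG : MemLp (gaussCoord s) 2 μ := memLp_gaussCoord s
  have hcross : ∫ ξ, inner ℝ (∑ j, a j * quadrantSign (v j) ξ) (gaussCoord s ξ) ∂μ =
      2 / √Real.pi * ‖s‖ ^ 2 := by
    -- The scalars are moved to the Gaussian side, which is conjugate-compatible with them; the
    -- rounding is not linear in its vector.
    have h1 : ∀ ξ, inner ℝ (∑ j, a j * quadrantSign (v j) ξ) (gaussCoord s ξ) =
        ∑ j, inner ℝ (quadrantSign (v j) ξ) (gaussCoord (star (a j) • s) ξ) := by
      intro ξ
      rw [sum_inner]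
      refine Finset.sum_congr rfl fun j _ => ?_
      simp only [Complex.inner, gaussCoord, inner_smul_right, map_mul, Complex.star_def]
      ring_nf
    simp_rw [h1]
    rw [integral_finsetSum]
    · simp_rw [μ, integral_re_quadrantSign_mul_conj_gaussCoord]
      rw [← Finset.mul_sum, ← real_inner_self_eq_norm_sq]
      congr 1
      conv_rhs => enter [2]; rw [hs]
      rw [sum_inner]
      refine Finset.sum_congr rfl fun j _ => ?_
      rw [real_inner_eq_re_inner_euclidean, real_inner_eq_re_inner_euclidean, inner_smul_left,
        inner_smul_right]
      rfl
    · intro j _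
      exact integrable_inner_of_memLp_two (memLp_quadrantSign (v j)) (memLp_gaussCoord _)
  have hpt : ∀ ξ, 2 * t * inner ℝ (∑ j, a j * quadrantSign (v j) ξ) (gaussCoord s ξ) -
      t ^ 2 * ‖gaussCoord s ξ‖ ^ 2 ≤ ‖∑ j, a j * quadrantSign (v j) ξ‖ ^ 2 := by
    intro ξ
    have := sq_nonneg ‖(∑ j, a j * quadrantSign (v j) ξ) - t • gaussCoord s ξ‖
    rw [norm_sub_sq_real, real_inner_smul_right, norm_smul, mul_pow, Real.norm_eq_abs,
      sq_abs] at this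
    linarith
  have hint := integral_mono
    (((integrable_inner_of_memLp_two hU hG).const_mul (2 * t)).sub
      ((hG.integrable_norm_pow two_ne_zero).const_mul (t ^ 2)))
    (hU.integrable_norm_pow two_ne_zero) hpt
  refine le_trans (le_of_eq ?_) hint
  rw [integral_sub' ((integrable_inner_of_memLp_two hU hG).const_mul (2 * t))
    ((hG.integrable_norm_pow two_ne_zero).const_mul (t ^ 2)), integral_const_mul,
    integral_const_mul, hcross, integral_norm_sq_gaussCoord]
  have hp : √Real.pi ^ 2 = Real.pi := Real.sq_sqrt Real.pi_pos.le
  have : √Real.pi ≠ 0 := by positivity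
  conv_lhs => rw [← hp]
  rw [ht]
  field_simp
  ring
end

/-! ### The little Grothendieck inequality with constant `π / 2`, and its Hilbert space form. -/

section
variable {m n : ℕ}

theorem opNorm_nonneg {p q : Type*} [Fintype p] [Fintype q] [DecidableEq q] (A : Matrix p q ℂ) :
    0 ≤ opNorm A := norm_nonneg _

theorem norm_toEuclideanLin_le {p q : Type*} [Fintype p] [Fintype q] [DecidableEq q]
    (A : Matrix p q ℂ) (x : EuclideanSpace ℂ q) :
    ‖Matrix.toEuclideanLin A x‖ ≤ opNorm A * ‖x‖ :=
  ContinuousLinearMap.le_opNorm (LinearMap.toContinuousLinearMap (Matrix.toEuclideanLin A)) x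

theorem opNorm_le {p q : Type*} [Fintype p] [Fintype q] [DecidableEq q]
    (A : Matrix p q ℂ) {c : ℝ} (hc : 0 ≤ c)
    (h : ∀ x : EuclideanSpace ℂ q, ‖Matrix.toEuclideanLin A x‖ ≤ c * ‖x‖) : opNorm A ≤ c :=
  ContinuousLinearMap.opNorm_le_bound (LinearMap.toContinuousLinearMap (Matrix.toEuclideanLin A))
    hc h

theorem normF_nonneg (X : Matrix (Fin m) (Fin n) ℂ) : 0 ≤ normF X := norm_nonneg _

theorem norm_mulVec_le_normF (X : Matrix (Fin m) (Fin n) ℂ) (u : Fin n → ℂ) :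
    ‖WithLp.toLp 2 (X.mulVec u)‖ ≤ normF X * ‖u‖ :=
  ContinuousLinearMap.le_opNorm (LinearMap.toContinuousLinearMap
    ((WithLp.linearEquiv 2 ℂ (Fin m → ℂ)).symm.toLinearMap ∘ₗ X.mulVecLin)) u

/-- Convex hulls commute with products, and the hull of the circle is the disc. This allows `normF`
to be tested on the unimodular vectors that generate `setR`. -/
theorem convexHull_unimodular :
    convexHull ℝ {u : Fin n → ℂ | ∀ j, ‖u j‖ = 1} = {u | ∀ j, ‖u j‖ ≤ 1} := by
  have h := convexHull_pi (𝕜 := ℝ) (Set.univ : Set (Fin n))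
    (fun _ => Metric.sphere (0 : ℂ) 1)
  simp_rw [convexHull_sphere_eq_closedBall (0 : ℂ) zero_le_one] at h
  have e1 : {u : Fin n → ℂ | ∀ j, ‖u j‖ = 1} =
      Set.univ.pi (fun _ => Metric.sphere (0 : ℂ) 1) := by ext; simp
  have e2 : {u : Fin n → ℂ | ∀ j, ‖u j‖ ≤ 1} =
      Set.univ.pi (fun _ => Metric.closedBall (0 : ℂ) 1) := by ext; simp
  rw [e1, e2, h]

/-- The supremum defining `normF` may be taken over vectors with unimodular entries. -/
theorem normF_le_of_unimodular (X : Matrix (Fin m) (Fin n) ℂ) {c : ℝ} (hc : 0 ≤ c)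
    (h : ∀ u : Fin n → ℂ, (∀ j, ‖u j‖ = 1) → ‖WithLp.toLp 2 (X.mulVec u)‖ ≤ c) :
    normF X ≤ c := by
  have hball : ∀ u : Fin n → ℂ, (∀ j, ‖u j‖ ≤ 1) → ‖WithLp.toLp 2 (X.mulVec u)‖ ≤ c := by
    intro u hu
    let F : (Fin n → ℂ) →ₗ[ℝ] EuclideanSpace ℂ (Fin m) :=
      ((WithLp.linearEquiv 2 ℂ (Fin m → ℂ)).symm.toLinearMap ∘ₗ X.mulVecLin).restrictScalars ℝ
    have hconv : Convex ℝ (F ⁻¹' Metric.closedBall 0 c) :=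
      (convex_closedBall _ _).linear_preimage F
    have hsub : {u : Fin n → ℂ | ∀ j, ‖u j‖ = 1} ⊆ F ⁻¹' Metric.closedBall 0 c := by
      intro u hu
      simpa [F] using h u hu
    have hmem := convexHull_min hsub hconv (convexHull_unimodular.ge hu)
    simpa [F] using hmem
  refine ContinuousLinearMap.opNorm_le_bound _ hc fun u => ?_
  rcases eq_or_ne u 0 with rfl | hu
  · simp
  have hu' : 0 < ‖u‖ := norm_pos_iff.2 hu
  have h1 := hball ((‖u‖⁻¹ : ℂ) • u) fun j => by
    rw [Pi.smul_apply, norm_smul, norm_inv, Complex.norm_real, norm_norm, inv_mul_le_one₀ hu']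
    exact norm_le_pi_norm u j
  rw [Matrix.mulVec_smul, WithLp.toLp_smul, norm_smul, norm_inv, Complex.norm_real, norm_norm,
    inv_mul_le_iff₀ hu', mul_comm] at h1
  exact h1

/-- The little Grothendieck inequality for vectors in a Hilbert space, with constant `π / 2`. -/
theorem sum_norm_sq_le_normF_sq {k : ℕ} (X : Matrix (Fin m) (Fin n) ℂ)
    (v : Fin n → EuclideanSpace ℂ (Fin k)) {r : ℝ} (hv : ∀ j, ‖v j‖ ≤ r) (hr : 0 ≤ r) :
    ∑ i, ‖∑ j, X i j • v j‖ ^ 2 ≤ Real.pi / 2 * (normF X * r) ^ 2 := by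
  have hU : ∀ i, Integrable (fun ξ => ‖∑ j, X i j * quadrantSign (v j) ξ‖ ^ 2)
      (stdGaussian (EuclideanSpace ℂ (Fin k))) := fun i =>
    MemLp.integrable_norm_pow (memLp_finsetSum _ fun j _ =>
      (memLp_quadrantSign (v j)).const_mul (X i j)) two_ne_zero
  have h1 : 2 / Real.pi * ∑ i, ‖∑ j, X i j • v j‖ ^ 2 ≤
      ∫ ξ, ∑ i, ‖∑ j, X i j * quadrantSign (v j) ξ‖ ^ 2
        ∂(stdGaussian (EuclideanSpace ℂ (Fin k))) := by
    rw [integral_finsetSum _ fun i _ => hU i, Finset.mul_sum]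
    exact Finset.sum_le_sum fun i _ => norm_sq_sum_smul_le_integral (X i) v
  have h2 : ∫ ξ, ∑ i, ‖∑ j, X i j * quadrantSign (v j) ξ‖ ^ 2
        ∂(stdGaussian (EuclideanSpace ℂ (Fin k))) ≤
      ∫ _, (normF X * r) ^ 2 ∂(stdGaussian (EuclideanSpace ℂ (Fin k))) := by
    refine integral_mono (integrable_finsetSum _ fun i _ => hU i) (integrable_const _) fun ξ => ?_
    have h3 := norm_mulVec_le_normF X fun j => quadrantSign (v j) ξ
    have h4 : ‖fun j => quadrantSign (v j) ξ‖ ≤ r :=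
      (pi_norm_le_iff_of_nonneg hr).2 fun j => (norm_quadrantSign_le _ _).trans (hv j)
    have h5 := pow_le_pow_left₀ (norm_nonneg _)
      (h3.trans (mul_le_mul_of_nonneg_left h4 (normF_nonneg X))) 2
    rw [EuclideanSpace.norm_sq_eq] at h5
    exact h5
  rw [integral_const, probReal_univ, one_smul] at h2
  have hp := Real.pi_pos
  have h6 := mul_le_mul_of_nonneg_left (h1.trans h2) (by positivity : 0 ≤ Real.pi / 2)
  refine le_trans (le_of_eq ?_) h6
  field_simp

/-- The action of an amplification of `F_X` on a vector, row by row. -/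
theorem norm_sq_amplification {k : ℕ} (X : Matrix (Fin m) (Fin n) ℂ)
    (a : Matrix (Fin k) (Fin k) (Fin n → ℂ)) (ξ : EuclideanSpace ℂ (Fin k)) :
    ‖Matrix.toEuclideanLin (Matrix.of fun (ip : Fin m × Fin k) (q : Fin k) =>
      (a.map X.mulVecLin) ip.2 q ip.1) ξ‖ ^ 2 =
    ∑ i, ‖∑ j, X i j • Matrix.toEuclideanLin (a.map fun z => z j) ξ‖ ^ 2 := by
  rw [EuclideanSpace.norm_sq_eq, Fintype.sum_prod_type]
  refine Finset.sum_congr rfl fun i _ => ?_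
  rw [EuclideanSpace.norm_sq_eq]
  refine Finset.sum_congr rfl fun p _ => ?_
  congr 2
  simp only [Matrix.toLpLin_apply, Matrix.mulVec, dotProduct, Matrix.of_apply,
    Matrix.map_apply, Matrix.mulVecLin_apply, WithLp.ofLp_sum, Finset.sum_apply,
    WithLp.ofLp_smul, Pi.smul_apply, smul_eq_mul, Finset.sum_mul, Finset.mul_sum, mul_assoc]
  exact Finset.sum_comm

theorem opNorm_map_le_matNormAlg {k : ℕ} (a : Matrix (Fin k) (Fin k) (Fin n → ℂ)) (j : Fin n) :
    opNorm (a.map fun z => z j) ≤ matNormAlg a :=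
  le_ciSup (f := fun j : Fin n => opNorm (a.map fun z => z j)) (Set.finite_range _).bddAbove j

/-- For `a` in the unit ball, the vectors `v j = a(j) ξ` have norm at most `‖ξ‖`, so the
vector-valued inequality applies to them. -/
theorem normCbF_le (X : Matrix (Fin m) (Fin n) ℂ) : normCbF X ≤ √(Real.pi / 2) * normF X := by
  have h0 : 0 ≤ √(Real.pi / 2) * normF X := mul_nonneg (Real.sqrt_nonneg _) (normF_nonneg X)
  refine Real.sSup_le ?_ h0
  rintro c ⟨k, a, ha, rfl⟩
  refine opNorm_le _ h0 fun ξ => ?_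
  refine le_of_sq_le_sq ?_ (by positivity)
  rw [norm_sq_amplification]
  refine (sum_norm_sq_le_normF_sq X _ (r := ‖ξ‖) (fun j => ?_) (norm_nonneg _)).trans_eq ?_
  · refine (norm_toEuclideanLin_le _ _).trans (mul_le_of_le_one_left (norm_nonneg _) ?_)
    exact (opNorm_map_le_matNormAlg a j).trans ha
  · rw [mul_pow, mul_pow, mul_pow, Real.sq_sqrt (by positivity)]
    ring

theorem sum_norm_sq_le_normCbF_sq {k : ℕ} (X : Matrix (Fin m) (Fin n) ℂ)
    (v : Fin n → EuclideanSpace ℂ (Fin k)) (hv : ∀ j, ‖v j‖ ≤ 1) :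
    ∑ i, ‖∑ j, X i j • v j‖ ^ 2 ≤ normCbF X ^ 2 := by
  cases k with
  | zero =>
    have : ∀ x : EuclideanSpace ℂ (Fin 0), ‖x‖ = 0 := fun x => by
      rw [Subsingleton.elim x 0, norm_zero]
    simp only [this]
    simpa using sq_nonneg (normCbF X)
  | succ k =>
    -- At the point `j` this matrix has first column `v j` and zeros elsewhere, a contraction; its
    -- amplification is evaluated at the first basis vector.
    set a : Matrix (Fin (k + 1)) (Fin (k + 1)) (Fin n → ℂ) :=
      Matrix.of fun p q j => if q = 0 then v j p else 0 with ha
    have happ : ∀ j (ξ : EuclideanSpace ℂ (Fin (k + 1))),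
        Matrix.toEuclideanLin (a.map fun z => z j) ξ = ξ 0 • v j := by
      intro j ξ
      ext p
      simp [ha, Matrix.mulVec, dotProduct, mul_comm]
    have h1 : matNormAlg a ≤ 1 := by
      refine Real.iSup_le (fun j => opNorm_le _ zero_le_one fun ξ => ?_) zero_le_one
      rw [happ, norm_smul, one_mul]
      exact (mul_le_of_le_one_right (norm_nonneg _) (hv j)).trans (PiLp.norm_apply_le ξ 0)
    have h2 : matNormCol (a.map X.mulVecLin) ≤ normCbF X :=
      le_csSup (bddAbove_cbSet X) ⟨k + 1, a, h1, rfl⟩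
    set e : EuclideanSpace ℂ (Fin (k + 1)) := EuclideanSpace.single 0 1 with he
    have h3 := norm_toEuclideanLin_le (Matrix.of fun (ip : Fin m × Fin (k + 1))
      (q : Fin (k + 1)) => (a.map X.mulVecLin) ip.2 q ip.1) e
    have h4 := pow_le_pow_left₀ (norm_nonneg _) h3 2
    rw [norm_sq_amplification] at h4
    have he0 : e 0 = 1 := by simp [he]
    have hen : ‖e‖ = 1 := by simp [he]
    simp only [happ, he0, one_smul, hen, mul_one] at h4
    exact h4.trans (pow_le_pow_left₀ (opNorm_nonneg _) h2 2)

theorem pi_div_two_mem_littleGrothendieckSet : Real.pi / 2 ∈ littleGrothendieckSet :=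
  ⟨by positivity, fun _ _ X => normCbF_le X⟩

theorem kGC_lt_two : kGC < 2 := by
  have h : kGC ≤ Real.pi / 2 :=
    csInf_le ⟨0, fun _ hK => hK.1.le⟩ pi_div_two_mem_littleGrothendieckSet
  linarith [Real.pi_lt_four]

end

/-! ### The sets `setR` and `setQ`, and the duality. -/

section
variable {n : ℕ}

instance locallyConvexSpace_matrix : LocallyConvexSpace ℝ (Matrix (Fin n) (Fin n) ℂ) :=
  inferInstanceAs (LocallyConvexSpace ℝ (Fin n → Fin n → ℂ))

theorem mem_unitary_pi_iff (u : Fin n → ℂ) : u ∈ unitary (Fin n → ℂ) ↔ ∀ j, ‖u j‖ = 1 := by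
  rw [Unitary.mem_iff]
  constructor
  · rintro ⟨h, -⟩ j
    have h1 := congrFun h j
    simp only [Pi.mul_apply, Pi.star_apply, Pi.one_apply, Complex.star_def,
      Complex.conj_mul'] at h1
    have h2 : ‖u j‖ ^ 2 = 1 := by exact_mod_cast h1
    exact (pow_eq_one_iff_of_nonneg (norm_nonneg _) two_ne_zero).1 h2
  · intro h
    constructor <;> ext j <;> simp [Complex.conj_mul', Complex.mul_conj', h j]

theorem isCompact_setR : IsCompact (setR n) := by
  have hK : IsCompact (Set.univ.pi fun _ : Fin n => Set.univ.pi fun _ : Fin n =>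
      Metric.closedBall (0 : ℂ) 1) :=
    isCompact_univ_pi fun _ => isCompact_univ_pi fun _ => isCompact_closedBall 0 1
  refine hK.of_isClosed_subset isClosed_closure (closure_minimal (convexHull_min ?_ ?_)
    hK.isClosed)
  · rintro _ ⟨u, hu, rfl⟩ i - j -
    rw [mem_unitary_pi_iff] at hu
    simp [Matrix.vecMulVec_apply, hu]
  · exact convex_pi fun _ _ => convex_pi fun _ _ => convex_closedBall _ _

theorem convex_setR : Convex ℝ (setR n) := (convex_convexHull ℝ _).closure

theorem vecMulVec_mem_setR {u : Fin n → ℂ} (hu : ∀ j, ‖u j‖ = 1) :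
    Matrix.vecMulVec (star u) u ∈ setR n :=
  subset_closure (subset_convexHull ℝ _ ⟨u, (mem_unitary_pi_iff u).2 hu, rfl⟩)

theorem diag_of_mem_setR {R : Matrix (Fin n) (Fin n) ℂ} (hR : R ∈ setR n) (i : Fin n) :
    R i i = 1 := by
  have hcl : IsClosed {M : Matrix (Fin n) (Fin n) ℂ | M i i = 1} :=
    isClosed_eq (by fun_prop) continuous_const
  have hconv : Convex ℝ {M : Matrix (Fin n) (Fin n) ℂ | M i i = 1} := by
    intro A hA B hB a b _ _ hab
    simp only [Set.mem_ofPred_eq] at hA hB ⊢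
    simp only [Matrix.add_apply, Matrix.smul_apply, hA, hB]
    rw [← add_smul, hab, one_smul]
  refine closure_minimal (convexHull_min ?_ hconv) hcl hR
  rintro _ ⟨u, hu, rfl⟩
  rw [mem_unitary_pi_iff] at hu
  simp [Matrix.vecMulVec_apply, Complex.conj_mul', hu]

theorem isClosed_posSemidef : IsClosed {M : Matrix (Fin n) (Fin n) ℂ | M.PosSemidef} := by
  simp_rw [Matrix.posSemidef_iff_dotProduct_mulVec, Set.ofPred_and, Set.ofPred_forall]
  refine IsClosed.inter ?_ (isClosed_iInter fun x => ?_)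
  · exact isClosed_eq (by fun_prop) continuous_id
  · exact isClosed_le continuous_const (by fun_prop)

theorem convex_posSemidef : Convex ℝ {M : Matrix (Fin n) (Fin n) ℂ | M.PosSemidef} :=
  fun _ hA _ hB _ _ ha hb _ => (hA.smul ha).add (hB.smul hb)

theorem exists_eq_conjTranspose_mul_self {Q : Matrix (Fin n) (Fin n) ℂ} (hQ : Q.PosSemidef) :
    ∃ V : Matrix (Fin n) (Fin n) ℂ, Q = Vᴴ * V := by
  open scoped MatrixOrder Matrix.Norms.L2Operator in
  exact CStarAlgebra.nonneg_iff_eq_star_mul_self.mp hQ.nonneg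

/-- A real functional on matrices is the real part of a pairing with a complex matrix. -/
theorem exists_matrix_functional (f : Matrix (Fin n) (Fin n) ℂ →ₗ[ℝ] ℝ) :
    ∃ B : Matrix (Fin n) (Fin n) ℂ, ∀ x : Fin n → ℂ,
      f (Matrix.vecMulVec (star x) x) = (star x ⬝ᵥ B *ᵥ x).re := by
  -- With this sign, `Re (B j l * z)` is the value of `f` at the matrix with single entry `z`.
  refine ⟨Matrix.of fun j l => ⟨f (Matrix.single j l 1), -f (Matrix.single j l Complex.I)⟩,
    fun x => ?_⟩
  have hsingle : ∀ j l (z : ℂ), f (Matrix.single j l z) =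
      z.re * f (Matrix.single j l 1) + z.im * f (Matrix.single j l Complex.I) := by
    intro j l z
    rw [← smul_eq_mul, ← smul_eq_mul, ← map_smul, ← map_smul, ← map_add]
    congr 1
    rw [Matrix.smul_single, Matrix.smul_single, ← Matrix.single_add]
    congr 1
    simp [Complex.re_add_im]
  rw [Matrix.matrix_eq_sum_single (Matrix.vecMulVec (star x) x)]
  simp only [map_sum, dotProduct, Matrix.mulVec, Complex.re_sum, Finset.mul_sum]
  refine Finset.sum_congr rfl fun j _ => Finset.sum_congr rfl fun l _ => ?_
  rw [hsingle]
  simp [Matrix.vecMulVec_apply]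
  ring

/-- A real functional nonnegative on positive semidefinite matrices is given on rank one matrices
by the square of a seminorm `x ↦ ‖X x‖`. -/
theorem exists_matrix_of_nonneg_functional (f : Matrix (Fin n) (Fin n) ℂ →ₗ[ℝ] ℝ)
    (hf : ∀ P : Matrix (Fin n) (Fin n) ℂ, P.PosSemidef → 0 ≤ f P) :
    ∃ X : Matrix (Fin n) (Fin n) ℂ, ∀ x : Fin n → ℂ,
      f (Matrix.vecMulVec (star x) x) = ∑ i, ‖(X *ᵥ x) i‖ ^ 2 := by
  obtain ⟨B, hB⟩ := exists_matrix_functional f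
  -- Only the Hermitian part of `B` affects the real part of the form. It is positive semidefinite,
  -- and a factorisation `Xᴴ * X` of it provides `X`.
  set A : Matrix (Fin n) (Fin n) ℂ := (1 / 2 : ℂ) • (B + Bᴴ) with hA
  have hconj : ∀ x : Fin n → ℂ, star x ⬝ᵥ Bᴴ *ᵥ x = star (star x ⬝ᵥ B *ᵥ x) := by
    intro x
    rw [Matrix.star_dotProduct, Matrix.star_mulVec,
      Matrix.conjTranspose_conjTranspose, Matrix.dotProduct_mulVec]
  have hform : ∀ x : Fin n → ℂ,
      star x ⬝ᵥ A *ᵥ x = (f (Matrix.vecMulVec (star x) x) : ℂ) := by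
    intro x
    rw [hB, hA, Matrix.smul_mulVec, dotProduct_smul, Matrix.add_mulVec, dotProduct_add, hconj,
      Complex.star_def, Complex.add_conj, smul_eq_mul]
    push_cast
    ring
  have hApsd : A.PosSemidef := by
    refine Matrix.PosSemidef.of_dotProduct_mulVec_nonneg ?_ fun x => ?_
    · rw [Matrix.IsHermitian, hA, Matrix.conjTranspose_smul, Matrix.conjTranspose_add,
        Matrix.conjTranspose_conjTranspose, add_comm]
      simp
    · rw [hform]
      exact_mod_cast hf _ (Matrix.posSemidef_vecMulVec_star_self x)
  obtain ⟨X, hX⟩ := exists_eq_conjTranspose_mul_self hApsd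
  refine ⟨X, fun x => ?_⟩
  have h := hform x
  rw [hX, ← Matrix.mulVec_mulVec, Matrix.dotProduct_mulVec, ← Matrix.star_mulVec] at h
  have h2 : star (X *ᵥ x) ⬝ᵥ (X *ᵥ x) = ((∑ i, ‖(X *ᵥ x) i‖ ^ 2 : ℝ) : ℂ) := by
    simp [dotProduct, Complex.conj_mul']
  rw [h2] at h
  exact_mod_cast h.symm

theorem conjTranspose_mul_self_eq_sum (V : Matrix (Fin n) (Fin n) ℂ) :
    Vᴴ * V = ∑ p, Matrix.vecMulVec (star (V p)) (V p) := by
  ext i j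
  simp [Matrix.mul_apply, Matrix.sum_apply, Matrix.vecMulVec_apply]

theorem norm_column_eq_one {V : Matrix (Fin n) (Fin n) ℂ} (hV : ∀ i, (Vᴴ * V) i i = 1)
    (j : Fin n) : ‖WithLp.toLp 2 fun p => V p j‖ = 1 := by
  have h := hV j
  simp only [Matrix.mul_apply, Matrix.conjTranspose_apply, Complex.star_def,
    Complex.conj_mul'] at h
  have h2 : ‖WithLp.toLp 2 fun p => V p j‖ ^ 2 = 1 := by
    rw [EuclideanSpace.norm_sq_eq]
    exact_mod_cast h
  exact (pow_eq_one_iff_of_nonneg (norm_nonneg _) two_ne_zero).1 h2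

/-- Duality: a constant in the little Grothendieck inequality dominates, in the order of
positive semidefinite matrices, correlation matrices by elements of `setR`. -/
theorem exists_posSemidef_smul_sub {K : ℝ} (hK : K ∈ littleGrothendieckSet)
    {Q : Matrix (Fin n) (Fin n) ℂ} (hQ : Q ∈ setQ n) :
    ∃ R ∈ setR n, (K • R - Q).PosSemidef := by
  by_contra! hcon
  have hcomp : IsCompact ((fun R => K • R - Q) '' setR n) :=
    isCompact_setR.image (by fun_prop)
  have hconv : Convex ℝ ((fun R => K • R - Q) '' setR n) := by
    have h := (convex_setR (n := n)).affinity (-Q) K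
    simpa [sub_eq_neg_add] using h
  have hdisj : Disjoint ((fun R => K • R - Q) '' setR n)
      {M : Matrix (Fin n) (Fin n) ℂ | M.PosSemidef} := by
    rw [Set.disjoint_left]
    rintro _ ⟨R, hR, rfl⟩
    exact hcon R hR
  obtain ⟨f, a, b, hfa, hab, hfb⟩ :=
    geometric_hahn_banach_compact_closed hconv hcomp convex_posSemidef isClosed_posSemidef hdisj
  have hb0 : b < 0 := by simpa using hfb 0 Matrix.PosSemidef.zero
  have hpos : ∀ P : Matrix (Fin n) (Fin n) ℂ, P.PosSemidef → 0 ≤ f P := by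
    intro P hP
    by_contra! hneg
    -- Scaled so that `f` takes exactly the value `b`, which the strict separation forbids on the
    -- cone.
    have h1 := hfb ((b / f P) • P) (hP.smul (div_pos_of_neg_of_neg hb0 hneg).le)
    rw [map_smul, smul_eq_mul, div_mul_cancel₀ _ hneg.ne] at h1
    exact lt_irrefl _ h1
  obtain ⟨X, hX⟩ := exists_matrix_of_nonneg_functional f.toLinearMap hpos
  have hlt : ∀ R ∈ setR n, K * f R < f Q + a := by
    intro R hR
    have h := hfa _ ⟨R, hR, rfl⟩
    simp only [map_sub, map_smul, smul_eq_mul] at h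
    linarith
  obtain ⟨V, hV⟩ := exists_eq_conjTranspose_mul_self hQ.1
  -- `Q` is the Gram matrix of the columns of `V`, which are unit vectors. Together with `normCbF X
  -- ^ 2 ≤ f Q + a` and `a < b < 0` this will be contradictory.
  have hfQ : f Q ≤ normCbF X ^ 2 := by
    have h1 := sum_norm_sq_le_normCbF_sq X (fun j => WithLp.toLp 2 fun p => V p j)
      fun j => (norm_column_eq_one (fun i => hV ▸ hQ.2 i) j).le
    refine le_trans (le_of_eq ?_) h1
    rw [hV, conjTranspose_mul_self_eq_sum, map_sum]
    simp_rw [EuclideanSpace.norm_sq_eq]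
    rw [Finset.sum_comm]
    refine Finset.sum_congr rfl fun p _ => (hX (V p)).trans ?_
    refine Finset.sum_congr rfl fun i _ => ?_
    simp [Matrix.mulVec, dotProduct]
  -- `Real.sqrt` is `0` on negative numbers, so the sign must be known before squaring back.
  have hQ0 : 0 ≤ f Q + a := by
    have h1 := hlt _ (vecMulVec_mem_setR (n := n) (u := fun _ => 1) (by simp))
    exact (mul_nonneg hK.1.le (hpos _ (Matrix.posSemidef_vecMulVec_star_self _))).trans h1.le
  have hF : normF X ≤ √((f Q + a) / K) := by
    refine normF_le_of_unimodular X (Real.sqrt_nonneg _) fun u hu => ?_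
    refine Real.le_sqrt_of_sq_le ?_
    rw [EuclideanSpace.norm_sq_eq, le_div_iff₀' hK.1]
    have h1 := hlt _ (vecMulVec_mem_setR hu)
    exact (congrArg (K * ·) (hX u)).symm.le.trans h1.le
  have h1 : normCbF X ≤ √(f Q + a) := by
    refine (hK.2 n n X).trans ((mul_le_mul_of_nonneg_left hF (Real.sqrt_nonneg _)).trans_eq ?_)
    rw [← Real.sqrt_mul hK.1.le, mul_div_cancel₀ _ hK.1.ne']
  have h0 : 0 ≤ normCbF X := by
    refine Real.sSup_nonneg ?_
    rintro c ⟨k, a, -, rfl⟩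
    exact opNorm_nonneg _
  have h2 := pow_le_pow_left₀ h0 h1 2
  rw [Real.sq_sqrt hQ0] at h2
  linarith

/-- For size one, the duality compares `K` with the single entry `1`. -/
theorem one_le_of_mem_littleGrothendieckSet {K : ℝ} (hK : K ∈ littleGrothendieckSet) : 1 ≤ K := by
  have hQ : (1 : Matrix (Fin 1) (Fin 1) ℂ) ∈ setQ 1 := ⟨Matrix.PosSemidef.one, by simp⟩
  obtain ⟨R, hR, hP⟩ := exists_posSemidef_smul_sub hK hQ
  have h := hP.diag_nonneg (i := 0)
  rw [Matrix.sub_apply, Matrix.smul_apply, diag_of_mem_setR hR, Matrix.one_apply_eq,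
    Complex.real_smul, mul_one, sub_nonneg] at h
  exact_mod_cast h

/-- Each inequality is a closed condition on `K`. The condition `0 < K` is not, but it survives at
the infimum because of the lower bound `1`. -/
theorem isLeast_kGC : IsLeast littleGrothendieckSet kGC := by
  have hne : littleGrothendieckSet.Nonempty := ⟨_, pi_div_two_mem_littleGrothendieckSet⟩
  have hbdd : BddBelow littleGrothendieckSet := ⟨1, fun _ => one_le_of_mem_littleGrothendieckSet⟩
  refine ⟨⟨zero_lt_one.trans_le (le_csInf hne fun _ => one_le_of_mem_littleGrothendieckSet),
    fun m n X => ?_⟩, fun _ hK => csInf_le hbdd hK⟩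
  have hcl : IsClosed {K : ℝ | normCbF X ≤ √K * normF X} :=
    isClosed_le continuous_const (by fun_prop)
  exact closure_minimal (fun K hK => hK.2 m n X) hcl (csInf_mem_closure hne hbdd)

theorem exists_eq_smul_sub_smul {Q : Matrix (Fin n) (Fin n) ℂ} (hQ : Q ∈ setQ n) :
    ∃ R ∈ setR n, ∃ Q' ∈ setQ n, Q = kGC • R - (kGC - 1) • Q' := by
  obtain ⟨R, hR, hP⟩ := exists_posSemidef_smul_sub isLeast_kGC.1 hQ
  have hdiag : ∀ i, (kGC • R - Q) i i = ((kGC - 1 : ℝ) : ℂ) := by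
    intro i
    rw [Matrix.sub_apply, Matrix.smul_apply, diag_of_mem_setR hR, hQ.2 i, Complex.real_smul]
    push_cast
    ring
  -- If `k = 1` the remainder cannot be normalised, but it is positive semidefinite with trace zero,
  -- hence zero.
  rcases (one_le_of_mem_littleGrothendieckSet isLeast_kGC.1).eq_or_lt with h1 | h1
  · have h0 : kGC • R - Q = 0 := by
      refine hP.trace_eq_zero_iff.1 ?_
      simp only [Matrix.trace, Matrix.diag_apply, hdiag]
      simp [← h1]
    refine ⟨R, hR, Q, hQ, ?_⟩
    rw [← h1, sub_self, zero_smul, sub_zero, h1]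
    exact (sub_eq_zero.1 h0).symm
  · have hk : 0 < kGC - 1 := sub_pos.2 h1
    refine ⟨R, hR, (kGC - 1)⁻¹ • (kGC • R - Q), ⟨hP.smul (inv_pos.2 hk).le, fun i => ?_⟩, ?_⟩
    · rw [Matrix.smul_apply, hdiag, Complex.real_smul, ← Complex.ofReal_mul,
        inv_mul_cancel₀ hk.ne', Complex.ofReal_one]
    · rw [smul_smul, mul_inv_cancel₀ hk.ne', one_smul, sub_sub_cancel]

end

/-! ### Iteration and the final decomposition. -/

/-- A bounded set each of whose points is, up to a contraction of ratio `r`, in a compact convex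
set `D`, is contained in `D`. -/
theorem subset_of_forall_exists_eq_add_smul {E : Type*} [NormedAddCommGroup E] [NormedSpace ℝ E]
    {D S : Set E} (hDc : IsCompact D) (hD : Convex ℝ D) (hS : Bornology.IsBounded S) {r : ℝ}
    (hr0 : 0 ≤ r) (hr1 : r < 1)
    (h : ∀ x ∈ S, ∃ d ∈ D, ∃ y ∈ S, x = (1 - r) • d + r • y) : S ⊆ D := by
  intro x hx
  have hiter : ∀ N : ℕ, ∀ x ∈ S, ∃ d ∈ D, ∃ y ∈ S, x = (1 - r ^ N) • d + r ^ N • y := by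
    intro N
    induction N with
    | zero =>
      intro x hx
      obtain ⟨d, hd, -⟩ := h x hx
      exact ⟨d, hd, x, hx, by simp⟩
    | succ N ih =>
      intro x hx
      obtain ⟨d, hd, y, hy, hxy⟩ := h x hx
      obtain ⟨d', hd', z, hz, hyz⟩ := ih y hy
      have hpos : 0 < 1 - r ^ (N + 1) := sub_pos.2 (pow_lt_one₀ hr0 hr1 N.succ_ne_zero)
      have hN : 0 ≤ 1 - r ^ N := sub_nonneg.2 (pow_le_one₀ hr0 hr1.le)
      -- Convex weights, because `1 - r ^ (N + 1) = (1 - r) + r * (1 - r ^ N)`.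
      refine ⟨((1 - r) / (1 - r ^ (N + 1))) • d + (r * (1 - r ^ N) / (1 - r ^ (N + 1))) • d',
        hD hd hd' (div_nonneg (sub_pos.2 hr1).le hpos.le)
          (div_nonneg (mul_nonneg hr0 hN) hpos.le) ?_, z, hz, ?_⟩
      · rw [← add_div, div_eq_one_iff_eq hpos.ne']
        ring
      · rw [smul_add, smul_smul, smul_smul, mul_div_cancel₀ _ hpos.ne',
          mul_div_cancel₀ _ hpos.ne', hxy, hyz, smul_add, smul_smul, smul_smul, pow_succ']
        abel
  choose d hd y hy hxy using fun N => hiter N x hx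
  obtain ⟨C, hC⟩ := hDc.isBounded.exists_norm_le
  obtain ⟨C', hC'⟩ := hS.exists_norm_le
  have hlim : Filter.Tendsto (fun N => r ^ N * (C' + C)) Filter.atTop (nhds 0) := by
    simpa using (tendsto_pow_atTop_nhds_zero_of_lt_one hr0 hr1).mul_const (C' + C)
  refine hDc.isClosed.mem_of_tendsto (b := Filter.atTop) ?_ (Filter.Eventually.of_forall hd)
  refine tendsto_iff_norm_sub_tendsto_zero.2 (squeeze_zero (fun _ => norm_nonneg _) ?_ hlim)
  intro N
  have hdiff : x - d N = r ^ N • (y N - d N) := by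
    conv_lhs => rw [hxy N]
    module
  rw [norm_sub_rev, hdiff, norm_smul, Real.norm_of_nonneg (pow_nonneg hr0 N)]
  exact mul_le_mul_of_nonneg_left
    ((norm_sub_le _ _).trans (add_le_add (hC' _ (hy N)) (hC _ (hd N)))) (pow_nonneg hr0 N)

theorem norm_apply_le_one_of_mem_setQ {n : ℕ} {Q : Matrix (Fin n) (Fin n) ℂ} (hQ : Q ∈ setQ n)
    (i j : Fin n) : ‖Q i j‖ ≤ 1 := by
  obtain ⟨V, hV⟩ := exists_eq_conjTranspose_mul_self hQ.1
  have hcol := norm_column_eq_one (V := V) fun i => hV ▸ hQ.2 i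
  have h := norm_inner_le_norm (𝕜 := ℂ) (WithLp.toLp 2 fun p => V p i)
    (WithLp.toLp 2 fun p => V p j)
  rw [hcol, hcol, mul_one] at h
  refine le_trans (le_of_eq ?_) h
  rw [hV]
  simp [Matrix.mul_apply, PiLp.inner_apply, mul_comm]

open scoped Matrix.Norms.Elementwise in
theorem isBounded_setQ (n : ℕ) : Bornology.IsBounded (setQ n) :=
  isBounded_iff_forall_norm_le.2 ⟨1, fun _ hQ =>
    (pi_norm_le_iff_of_nonneg zero_le_one).2 fun i =>
      (pi_norm_le_iff_of_nonneg zero_le_one).2 fun j => norm_apply_le_one_of_mem_setQ hQ i j⟩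

open scoped Pointwise Matrix.Norms.Elementwise in
theorem setQ_subset (n : ℕ) :
    setQ n ⊆ (1 / (2 - kGC)) • setR n - ((kGC - 1) / (2 - kGC)) • setR n := by
  have hk1 := one_le_of_mem_littleGrothendieckSet isLeast_kGC.1
  have hk2 := kGC_lt_two
  -- The decomposition is used twice because one use leaves the negative coefficient `-(k - 1)`; two
  -- leave the ratio `(k - 1)²`, which lies in `[0, 1)`.
  refine subset_of_forall_exists_eq_add_smul (r := (kGC - 1) ^ 2)
    (by rw [sub_eq_add_neg]; exact (isCompact_setR.smul _).add (isCompact_setR.smul _).neg)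
    ((convex_setR.smul _).sub (convex_setR.smul _)) (isBounded_setQ n) (sq_nonneg _)
    (by nlinarith) fun Q hQ => ?_
  obtain ⟨R, hR, Q', hQ', h1⟩ := exists_eq_smul_sub_smul hQ
  obtain ⟨R', hR', Q'', hQ'', h2⟩ := exists_eq_smul_sub_smul hQ'
  refine ⟨_, Set.sub_mem_sub (Set.smul_mem_smul_set hR) (Set.smul_mem_smul_set hR'), Q'', hQ'', ?_⟩
  have hk : 2 - kGC ≠ 0 := by linarith
  have e1 : (1 - (kGC - 1) ^ 2) * (1 / (2 - kGC)) = kGC := by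
    field_simp
    ring
  have e2 : (1 - (kGC - 1) ^ 2) * ((kGC - 1) / (2 - kGC)) = (kGC - 1) * kGC := by
    field_simp
    ring
  have h3 : Q = (kGC • R - ((kGC - 1) * kGC) • R') + (kGC - 1) ^ 2 • Q'' := by
    rw [h1, h2]
    module
  rw [smul_sub, smul_smul, smul_smul, e1, e2]
  exact h3

theorem mainTheorem5 :
    IsLeast littleGrothendieckSet kGC ∧ kGC < 2 ∧
      ∀ (n : ℕ) (Q : Matrix (Fin n) (Fin n) ℂ), Q ∈ setQ n →
        ∃ Rplus ∈ setR n, ∃ Rminus ∈ setR n,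
          Q = (1 / (2 - kGC)) • Rplus - ((kGC - 1) / (2 - kGC)) • Rminus := by
  refine ⟨isLeast_kGC, kGC_lt_two, fun n Q hQ => ?_⟩
  obtain ⟨_, ⟨Rplus, hRplus, rfl⟩, _, ⟨Rminus, hRminus, rfl⟩, h⟩ := setQ_subset n hQ
  exact ⟨Rplus, hRplus, Rminus, hRminus, h.symm⟩
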